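/- Let $\mathbb F=\mathbb R$ or $\mathbb C$, let $d\ge 0$ and let $N\ge 2$ be even. Let $\Sigma\in\mathbb F^{d\times d}$ be positive semidefinite with positive semidefinite square root $\Sigma^{1/2}$, and let $a\ge 0$. For $W_1,\dots,W_N\in\mathbb F^{d\times d}$ put $W=W_NW_{N-1}\cdots W_1$ and $$\mathcal L(W_1,\dots,W_N)=\tfrac12\|\Sigma-W\|_F^2+\tfrac a4\sum_{j=1}^{N-1}\|W_jW_j^H-W_{j+1}^HW_{j+1}\|_F^2 .$$ Let $W_1(t),\dots,W_N(t)$, $t\in[0,\infty)$, solve the gradient flow $\frac{\mathrm d}{\mathrm dt}W_j=-\nabla_{W_j}\mathcal L$, $1\le j\le N$ (the gradient being taken for the real inner product $\langle G,H\rangle=\Re\,\mathrm{tr}(G^HH)$), with balanced initialization: $W_j(0)W_j(0)^H=W_{j+1}(0)^HW_{j+1}(0)$ for $1\le j\le N-1$. For every $t\ge 0$ let $W(t)=U(t)\,\Sigma_w(t)^N\,V(t)^H$ be a singular value decomposition of the product matrix, where $U(t),V(t)$ are unitary (orthogonal if $\mathbb F=\mathbb R$) and $\Sigma_w(t)=\mathrm{diag}(s_1(t),\dots,s_d(t))$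 with $s_i(t)\ge 0$ in any order (for instance, the analytic singular value decomposition). Assume that all singular values $s_i(0)^N$ of $W(0)$ are different from zero. Then for every $t\ge 0$ the function $\|\Sigma^{1/2}(U-V)\Sigma_w\|_F^2$ is differentiable at $t$ (from the right if $t=0$), and $$\begin{aligned}\frac{\mathrm d}{\mathrm dt}\left\|\Sigma^{1/2}(U-V)\Sigma_w\right\|_F^2={}&-2\left\|\Sigma(U-V)\Sigma_w^{N/2}\right\|_F^2-2\left\|\Sigma^{1/2}(U-V)\Sigma_w^{N}\right\|_F^2\\&-2\,\Re\,\mathrm{tr}\Big(\sum_{j=1}^{N/2-1}\Sigma U\Sigma_w^{2j}\left(U^H\Sigma V-V^H\Sigma U\right)\Sigma_w^{N-2j}V^H\Big).\end{aligned}$$ With $Q=U^H\Sigma V$, the right-hand side is equal to $$-2\left\|\Sigma(U-V)\Sigma_w^{N/2}\right\|_F^2-2\left\|\Sigma^{1/2}(U-V)\Sigma_w^{N}\right\|_F^2-\sum_{m,n}\left|Q_{mn}-\overline{Q_{nm}}\right|^2\Big(\sum_{j=1}^{N/2-1}s_m^{2j}s_n^{N-2j}\Big),$$ where, if $N\ge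 4$, all the weights $\sum_{j=1}^{N/2-1}s_m^{2j}s_n^{N-2j}$ are positive (if $N=2$ these sums are empty). In particular $\frac{\mathrm d}{\mathrm dt}\|\Sigma^{1/2}(U-V)\Sigma_w\|_F^2\le 0$. -/

import Mathlib

open scoped Matrix ComplexOrder MatrixOrder

attribute [local instance] Matrix.frobeniusNormedAddCommGroup Matrix.frobeniusNormedSpace

namespace DeepMF

variable {𝕜 : Type*} [RCLike 𝕜] {d : ℕ}

/-- The ordered product `W_k * W_(k-1) * ⋯ * W_1` of the first `k` layers.  Layers are numbered
`1, …, N`; the other values of the family `W : ℕ → Matrix _ _ 𝕜` are never used. -/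
def layerProd (W : ℕ → Matrix (Fin d) (Fin d) 𝕜) : ℕ → Matrix (Fin d) (Fin d) 𝕜
  | 0 => 1
  | k + 1 => W (k + 1) * layerProd W k

/-- The balance error `Δ_{j,j+1} = W_j W_jᴴ - W_{j+1}ᴴ W_{j+1}`. -/
def balanceError (W : ℕ → Matrix (Fin d) (Fin d) 𝕜) (j : ℕ) : Matrix (Fin d) (Fin d) 𝕜 :=
  W j * (W j)ᴴ - (W (j + 1))ᴴ * W (j + 1)

/-- The layers `W_1, …, W_N` are balanced: `W_j W_jᴴ = W_{j+1}ᴴ W_{j+1}` for `1 ≤ j ≤ N - 1`. -/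
def IsBalanced (N : ℕ) (W : ℕ → Matrix (Fin d) (Fin d) 𝕜) : Prop :=
  ∀ j ∈ Finset.Ico 1 N, balanceError W j = 0

/-- The training loss
`1/2 ‖S - W_N ⋯ W_1‖_F² + a/4 ∑_{j=1}^{N-1} ‖Δ_{j,j+1}‖_F²` with target `S`. The norm is the
Frobenius norm. -/
noncomputable def loss (N : ℕ) (a : ℝ) (S : Matrix (Fin d) (Fin d) 𝕜)
    (W : ℕ → Matrix (Fin d) (Fin d) 𝕜) : ℝ :=
  1 / 2 * ‖S - layerProd W N‖ ^ 2 + a / 4 * ∑ j ∈ Finset.Ico 1 N, ‖balanceError W j‖ ^ 2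

/-- `G` is the gradient of `L` with respect to the layer `W_j` at `W`, for the real inner product
`⟨G, H⟩ = Re tr(Gᴴ H)` on matrices: the derivative of `L` at `W` when the `j`-th layer moves in the
direction `H` equals `Re tr(Gᴴ H)`, for every `H`. -/
def IsLayerGradient (L : (ℕ → Matrix (Fin d) (Fin d) 𝕜) → ℝ)
    (W : ℕ → Matrix (Fin d) (Fin d) 𝕜) (j : ℕ) (G : Matrix (Fin d) (Fin d) 𝕜) : Prop :=
  ∀ H : Matrix (Fin d) (Fin d) 𝕜,
    HasDerivAt (fun ε : ℝ => L (Function.update W j (W j + ε • H)))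
      (RCLike.re (Matrix.trace (Gᴴ * H))) 0

/-- `t ↦ (W t 1, …, W t N)` solves the gradient flow `dW_j/dt = -∇_{W_j} loss` on `[0, ∞)`
(with the one-sided derivative at `t = 0`). -/
def IsGradientFlow (N : ℕ) (a : ℝ) (S : Matrix (Fin d) (Fin d) 𝕜)
    (W : ℝ → ℕ → Matrix (Fin d) (Fin d) 𝕜) : Prop :=
  ∀ t : ℝ, 0 ≤ t → ∀ j ∈ Finset.Icc 1 N, ∃ G : Matrix (Fin d) (Fin d) 𝕜,
    IsLayerGradient (loss N a S) (W t) j G ∧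
      HasDerivWithinAt (fun τ => W τ j) (-G) (Set.Ici 0) t

/-- The real diagonal matrix with diagonal `s`, with entries in `𝕜`. -/
def diagMat (𝕜 : Type*) [RCLike 𝕜] {d : ℕ} (s : Fin d → ℝ) : Matrix (Fin d) (Fin d) 𝕜 :=
  Matrix.diagonal fun i => (s i : 𝕜)

/-- `M = U Σ_w^N Vᴴ` is a singular value decomposition of `M`, where `U`, `V` are unitary
(orthogonal if `𝕜 = ℝ`) and `Σ_w = diag(s)` with `s ≥ 0`, the entries of `s` being in any order. -/
structure IsRootSVD (N : ℕ) (M U : Matrix (Fin d) (Fin d) 𝕜) (s : Fin d → ℝ)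
    (V : Matrix (Fin d) (Fin d) 𝕜) : Prop where
  unitary_left : U ∈ Matrix.unitaryGroup (Fin d) 𝕜
  unitary_right : V ∈ Matrix.unitaryGroup (Fin d) 𝕜
  nonneg : ∀ i, 0 ≤ s i
  eq : M = U * diagMat 𝕜 s ^ N * Vᴴ

/-- The skew-Hermitian error `‖S^{1/2} (U - V) Σ_w‖_F²`, with `S^{1/2}` the positive semidefinite
square root of `S` and `Σ_w = diag(s)`. -/
noncomputable def skewError (S U : Matrix (Fin d) (Fin d) 𝕜) (s : Fin d → ℝ)
    (V : Matrix (Fin d) (Fin d) 𝕜) : ℝ :=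
  ‖CFC.sqrt S * (U - V) * diagMat 𝕜 s‖ ^ 2

/-- The claimed rate of change of the skew-Hermitian error, in matrix form. -/
noncomputable def skewErrorRate (N : ℕ) (S U : Matrix (Fin d) (Fin d) 𝕜) (s : Fin d → ℝ)
    (V : Matrix (Fin d) (Fin d) 𝕜) : ℝ :=
  -2 * ‖S * (U - V) * diagMat 𝕜 s ^ (N / 2)‖ ^ 2
    - 2 * ‖CFC.sqrt S * (U - V) * diagMat 𝕜 s ^ N‖ ^ 2
    - 2 * RCLike.re (Matrix.trace (∑ j ∈ Finset.Icc 1 (N / 2 - 1),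
        S * U * diagMat 𝕜 s ^ (2 * j) * (Uᴴ * S * V - Vᴴ * S * U)
          * diagMat 𝕜 s ^ (N - 2 * j) * Vᴴ))

/-- The weight `∑_{j=1}^{N/2-1} s_m^{2j} s_n^{N-2j}`. -/
def skewWeight (N : ℕ) (s : Fin d → ℝ) (m n : Fin d) : ℝ :=
  ∑ j ∈ Finset.Icc 1 (N / 2 - 1), s m ^ (2 * j) * s n ^ (N - 2 * j)

end DeepMF

/-!
The singular value decomposition in the statement is arbitrary at every time, so `U`, `V` and `Σ_w`
cannot be differentiated.  The proof rests on the fact that the three matrices that make up the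
skew-Hermitian error,
`‖S^{1/2} (U - V) Σ_w‖² = Re tr S (U Σ_w² Uᴴ + V Σ_w² Vᴴ) - 2 Re tr S U Σ_w² Vᴴ`,
are differentiable functions of the layers, the last one as long as `W` is invertible.

* The sum of the squared balance errors can only decrease along the flow
  (`IsGradientFlow.isBalanced`): its gradient is orthogonal to the gradient of the data-fitting
  term.  Hence the layers stay balanced, the penalty does not contribute, and uniqueness of positive
  semidefinite roots gives `U Σ_w² Uᴴ = W_N W_Nᴴ` and `V Σ_w² Vᴴ = W_1ᴴ W_1`
  (`IsRootSVD.last_mul_conjTranspose`, `IsRootSVD.conjTranspose_mul_first`).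
* Jacobi's formula shows that `f = det (W_1ᴴ W_1)` satisfies `f' = c f` with `c` locally bounded, so
  the singular values stay positive (`IsGradientFlow.singularValue_pos`).
* As `N = 2 k + 2` is even, `U Σ_w² Vᴴ = W (W_1ᴴ W_1)^{-k}` with an integer exponent.  Its
  derivative solves a linear equation, whose solution is `crossVelocity`, a polynomial in `Σ_w²`,
  `Q = Uᴴ S V` and `Qᴴ` (`IsGradientFlow.hasDerivWithinAt_cross`).

Adding up the three derivatives gives the rate (`skewErrorRate_eq`).  Its last term is
the sum over `j` of `-2 Re tr Qᴴ Σ_w^{2j} (Q - Qᴴ) Σ_w^{N-2j}`.  The weights are symmetric in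
`(m, n)`, so pairing the entries `(m, n)` and `(n, m)` yields the sum of squares
(`skewErrorRate_eq_sum_sq`).
-/

namespace DeepMF

attribute [local instance] Matrix.frobeniusNormedRing Matrix.frobeniusNormedAlgebra

variable {𝕜 : Type*} [RCLike 𝕜] {d : ℕ}

/-! ### The real trace form -/

/-- The real part of the trace, as a continuous real-linear functional.  The real inner product of
matrices is `⟨X, Y⟩ = reTr (Xᴴ * Y)`. -/
noncomputable def reTr : Matrix (Fin d) (Fin d) 𝕜 →L[ℝ] ℝ :=
  LinearMap.toContinuousLinearMap
    { toFun := fun X => RCLike.re (Matrix.trace X)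
      map_add' := fun X Y => by simp
      map_smul' := fun c X => by simp [RCLike.smul_re] }

lemma reTr_apply (X : Matrix (Fin d) (Fin d) 𝕜) : reTr X = RCLike.re (Matrix.trace X) := rfl

lemma reTr_conjTranspose (X : Matrix (Fin d) (Fin d) 𝕜) : reTr Xᴴ = reTr X := by
  simp [reTr_apply, Matrix.trace_conjTranspose]

lemma reTr_mul_comm (X Y : Matrix (Fin d) (Fin d) 𝕜) : reTr (X * Y) = reTr (Y * X) := by
  simp only [reTr_apply, Matrix.trace_mul_comm X Y]

lemma norm_sq_eq_reTr (X : Matrix (Fin d) (Fin d) 𝕜) : ‖X‖ ^ 2 = reTr (Xᴴ * X) := by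
  have h0 : (0 : ℝ) ≤ ∑ i, ∑ j, ‖X i j‖ ^ 2 := by positivity
  rw [Matrix.frobenius_norm_def, reTr_apply, Matrix.trace]
  norm_num
  rw [← Real.sqrt_eq_rpow, Real.sq_sqrt h0, Finset.sum_comm]
  refine Finset.sum_congr rfl fun i _ => ?_
  rw [Matrix.mul_apply, map_sum]
  refine Finset.sum_congr rfl fun j _ => ?_
  rw [Matrix.conjTranspose_apply, RCLike.star_def, RCLike.conj_mul]
  norm_cast

lemma reTr_conjTranspose_mul_self_nonneg (X : Matrix (Fin d) (Fin d) 𝕜) : 0 ≤ reTr (Xᴴ * X) := by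
  rw [← norm_sq_eq_reTr]; positivity

/-- The real trace form is nondegenerate. -/
lemma eq_of_reTr_conjTranspose_mul_eq {G G' : Matrix (Fin d) (Fin d) 𝕜}
    (h : ∀ H, reTr (Gᴴ * H) = reTr (G'ᴴ * H)) : G = G' := by
  have h1 : ‖G - G'‖ ^ 2 = 0 := by
    rw [norm_sq_eq_reTr, Matrix.conjTranspose_sub, sub_mul, map_sub, h, sub_self]
  exact sub_eq_zero.mp (norm_eq_zero.mp (by simpa using h1))

/-- The Cauchy–Schwarz inequality for the real trace form. -/
lemma abs_reTr_mul_le (X Y : Matrix (Fin d) (Fin d) 𝕜) : |reTr (X * Y)| ≤ ‖X‖ * ‖Y‖ := by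
  -- the quadratic polynomial `c ↦ ‖c Xᴴ + Y‖²` has a nonpositive discriminant
  have h : ∀ c : ℝ, 0 ≤ ‖X‖ ^ 2 * (c * c) + 2 * reTr (X * Y) * c + ‖Y‖ ^ 2 := by
    intro c
    have := reTr_conjTranspose_mul_self_nonneg (c • Xᴴ + Y)
    have e : reTr ((c • Xᴴ + Y)ᴴ * (c • Xᴴ + Y)) =
        ‖X‖ ^ 2 * (c * c) + 2 * reTr (X * Y) * c + ‖Y‖ ^ 2 := by
      have e1 : reTr (Yᴴ * Xᴴ) = reTr (X * Y) := by
        rw [← Matrix.conjTranspose_mul, reTr_conjTranspose]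
      have e2 : reTr (X * Xᴴ) = ‖X‖ ^ 2 := by rw [reTr_mul_comm, norm_sq_eq_reTr]
      simp only [Matrix.conjTranspose_add, Matrix.conjTranspose_smul,
        Matrix.conjTranspose_conjTranspose, star_trivial, add_mul, mul_add, smul_mul_assoc,
        mul_smul_comm, map_add, map_smul, smul_eq_mul, e1, e2, ← norm_sq_eq_reTr]
      ring
    rwa [e] at this
  have h2 := discrim_le_zero h
  unfold discrim at h2
  apply abs_le_of_sq_le_sq _ (by positivity)
  nlinarith

section Deriv

variable {X : ℝ → Matrix (Fin d) (Fin d) 𝕜} {X' : Matrix (Fin d) (Fin d) 𝕜} {u : Set ℝ} {t : ℝ}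

lemma hasDerivWithinAt_reTr (h : HasDerivWithinAt X X' u t) :
    HasDerivWithinAt (fun τ => reTr (X τ)) (reTr X') u t :=
  (reTr (𝕜 := 𝕜) (d := d)).hasFDerivAt.comp_hasDerivWithinAt t h

lemma hasDerivWithinAt_conjTranspose (h : HasDerivWithinAt X X' u t) :
    HasDerivWithinAt (fun τ => (X τ)ᴴ) X'ᴴ u t :=
  h.star

lemma hasDerivWithinAt_norm_sq (h : HasDerivWithinAt X X' u t) :
    HasDerivWithinAt (fun τ => ‖X τ‖ ^ 2) (2 * reTr ((X t)ᴴ * X')) u t := by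
  simp only [norm_sq_eq_reTr]
  refine (hasDerivWithinAt_reTr ((hasDerivWithinAt_conjTranspose h).fun_mul h)).congr_deriv ?_
  have : reTr (X'ᴴ * X t) = reTr ((X t)ᴴ * X') := by
    rw [← reTr_conjTranspose]; simp
  rw [map_add, this]; ring

end Deriv

/-! ### The gradient of the loss -/

/-- The product `W_k * W_(k-1) * ⋯ * W_(j+1)` of the layers above the `j`-th one. -/
def upperProd (W : ℕ → Matrix (Fin d) (Fin d) 𝕜) (j k : ℕ) : Matrix (Fin d) (Fin d) 𝕜 :=
  layerProd (fun i => W (j + i)) (k - j)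

lemma upperProd_self (W : ℕ → Matrix (Fin d) (Fin d) 𝕜) (k : ℕ) : upperProd W k k = 1 := by
  simp [upperProd, layerProd]

lemma upperProd_succ_right (W : ℕ → Matrix (Fin d) (Fin d) 𝕜) {j k : ℕ} (h : j ≤ k) :
    upperProd W j (k + 1) = W (k + 1) * upperProd W j k := by
  obtain ⟨m, rfl⟩ := Nat.exists_eq_add_of_le h
  simp [upperProd, add_assoc, layerProd]

lemma upperProd_eq_mul (W : ℕ → Matrix (Fin d) (Fin d) 𝕜) {j k : ℕ} (h : j < k) :
    upperProd W j k = upperProd W (j + 1) k * W (j + 1) := by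
  induction k, h using Nat.le_induction with
  | base => rw [upperProd_succ_right W le_rfl, upperProd_self, upperProd_self, one_mul, mul_one]
  | succ k hk ih =>
    rw [upperProd_succ_right W (by omega), ih, upperProd_succ_right W hk, mul_assoc]

lemma upperProd_zero (W : ℕ → Matrix (Fin d) (Fin d) 𝕜) (k : ℕ) :
    upperProd W 0 k = layerProd W k := by
  simp [upperProd]

/-- The product rule: each layer contributes its velocity between the layers above and below. -/
lemma hasDerivWithinAt_layerProd {γ : ℝ → ℕ → Matrix (Fin d) (Fin d) 𝕜}
    {γ' : ℕ → Matrix (Fin d) (Fin d) 𝕜} {u : Set ℝ} {t : ℝ} (k : ℕ)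
    (h : ∀ j ∈ Finset.Icc 1 k, HasDerivWithinAt (fun τ => γ τ j) (γ' j) u t) :
    HasDerivWithinAt (fun τ => layerProd (γ τ) k)
      (∑ j ∈ Finset.Icc 1 k, upperProd (γ t) j k * γ' j * layerProd (γ t) (j - 1)) u t := by
  induction k with
  | zero => exact hasDerivWithinAt_const t u (1 : Matrix (Fin d) (Fin d) 𝕜)
  | succ k ih =>
    have h1 := ih fun j hj => h j (Finset.Icc_subset_Icc_right (Nat.le_succ k) hj)
    have h2 := h (k + 1) (by simp)
    refine (h2.fun_mul h1).congr_deriv ?_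
    rw [Finset.sum_Icc_succ_top (by omega), upperProd_self, one_mul, Nat.add_sub_cancel, add_comm,
      Finset.mul_sum]
    congr 1
    refine Finset.sum_congr rfl fun j hj => ?_
    rw [upperProd_succ_right _ (Finset.mem_Icc.mp hj).2]
    simp only [mul_assoc]

/-- The gradient of `1/4 ∑ ‖Δ_{j,j+1}‖²` with respect to the layer `W_j`, that is
`Δ_{j,j+1} W_j - W_j Δ_{j-1,j}` with `Δ_{0,1} = Δ_{N,N+1} = 0`. -/
def balanceGrad (N : ℕ) (W : ℕ → Matrix (Fin d) (Fin d) 𝕜) (j : ℕ) : Matrix (Fin d) (Fin d) 𝕜 :=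
  (if j < N then balanceError W j * W j else 0)
    - (if 1 < j then W j * balanceError W (j - 1) else 0)

/-- The gradient of `1/2 ‖S - W_N ⋯ W_1‖²` with respect to the layer `W_j`. -/
def fitGrad (N : ℕ) (S : Matrix (Fin d) (Fin d) 𝕜) (W : ℕ → Matrix (Fin d) (Fin d) 𝕜) (j : ℕ) :
    Matrix (Fin d) (Fin d) 𝕜 :=
  -((upperProd W j N)ᴴ * (S - layerProd W N) * (layerProd W (j - 1))ᴴ)

lemma conjTranspose_balanceError (W : ℕ → Matrix (Fin d) (Fin d) 𝕜) (j : ℕ) :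
    (balanceError W j)ᴴ = balanceError W j := by
  simp [balanceError]

/-- Summation by parts: pairing directions `H_j` with the gradients `balanceGrad N W j` amounts to
pairing the balance errors with the infinitesimal changes `H_j W_jᴴ - W_{j+1}ᴴ H_{j+1}`. -/
lemma sum_reTr_balanceGrad (N : ℕ) (W H : ℕ → Matrix (Fin d) (Fin d) 𝕜) :
    ∑ j ∈ Finset.Icc 1 N, reTr ((balanceGrad N W j)ᴴ * H j) =
      ∑ j ∈ Finset.Ico 1 N,
        reTr (balanceError W j * (H j * (W j)ᴴ - (W (j + 1))ᴴ * H (j + 1))) := by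
  have key : ∀ (f g : ℕ → ℝ) (N : ℕ), ∑ j ∈ Finset.Icc 1 N,
      ((if j < N then f j else 0) - (if 1 < j then g j else 0)) =
      ∑ j ∈ Finset.Ico 1 N, (f j - g (j + 1)) := by
    intro f g N
    rcases N.eq_zero_or_pos with rfl | hN
    · simp
    rw [Finset.sum_sub_distrib, Finset.sum_sub_distrib]
    congr 1
    · rw [← Finset.sum_filter]
      congr 1
      ext j; simp; omega
    · rw [← Finset.sum_filter, Finset.sum_Ico_add' g 1 N 1]
      congr 1
      ext j; simp; omega
  rw [Finset.sum_congr rfl fun j _ => ?_]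
  · exact (key (fun j => reTr ((W j)ᴴ * balanceError W j * H j))
      (fun j => reTr (balanceError W (j - 1) * (W j)ᴴ * H j)) N).trans <|
      Finset.sum_congr rfl fun j _ => by
        rw [mul_sub, map_sub, ← mul_assoc, reTr_mul_comm _ (W j)ᴴ]
        simp only [Nat.add_sub_cancel, mul_assoc]
  · unfold balanceGrad
    split_ifs <;> simp [sub_mul, conjTranspose_balanceError]

lemma hasDerivWithinAt_sum_norm_sq_balanceError {γ : ℝ → ℕ → Matrix (Fin d) (Fin d) 𝕜}
    {γ' : ℕ → Matrix (Fin d) (Fin d) 𝕜} {u : Set ℝ} {t : ℝ} (N : ℕ)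
    (h : ∀ j ∈ Finset.Icc 1 N, HasDerivWithinAt (fun τ => γ τ j) (γ' j) u t) :
    HasDerivWithinAt (fun τ => ∑ j ∈ Finset.Ico 1 N, ‖balanceError (γ τ) j‖ ^ 2)
      (4 * ∑ j ∈ Finset.Icc 1 N, reTr ((balanceGrad N (γ t) j)ᴴ * γ' j)) u t := by
  rw [sum_reTr_balanceGrad, Finset.mul_sum]
  refine HasDerivWithinAt.fun_sum fun j hj => ?_
  have hj' := Finset.mem_Ico.mp hj
  have h1 := h j (by simp; omega)
  have h2 := h (j + 1) (by simp; omega)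
  have h3 := (h1.fun_mul (hasDerivWithinAt_conjTranspose h1)).fun_sub
    ((hasDerivWithinAt_conjTranspose h2).fun_mul h2)
  refine (hasDerivWithinAt_norm_sq (X := fun τ => balanceError (γ τ) j) h3).congr_deriv ?_
  have e1 : reTr (balanceError (γ t) j * (γ t j * (γ' j)ᴴ)) =
      reTr (balanceError (γ t) j * (γ' j * (γ t j)ᴴ)) := by
    rw [← reTr_conjTranspose, reTr_mul_comm]
    simp [conjTranspose_balanceError, mul_assoc]
  have e2 : reTr (balanceError (γ t) j * ((γ' (j + 1))ᴴ * γ t (j + 1))) =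
      reTr (balanceError (γ t) j * ((γ t (j + 1))ᴴ * γ' (j + 1))) := by
    rw [← reTr_conjTranspose]
    rw [Matrix.conjTranspose_mul, reTr_mul_comm]
    simp [conjTranspose_balanceError]
  simp only [conjTranspose_balanceError, mul_sub, mul_add, map_sub, map_add, e1, e2]
  ring

lemma hasDerivWithinAt_loss {γ : ℝ → ℕ → Matrix (Fin d) (Fin d) 𝕜}
    {γ' : ℕ → Matrix (Fin d) (Fin d) 𝕜} {u : Set ℝ} {t : ℝ} (N : ℕ) (a : ℝ)
    (S : Matrix (Fin d) (Fin d) 𝕜)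
    (h : ∀ j ∈ Finset.Icc 1 N, HasDerivWithinAt (fun τ => γ τ j) (γ' j) u t) :
    HasDerivWithinAt (fun τ => loss N a S (γ τ))
      (∑ j ∈ Finset.Icc 1 N, reTr ((fitGrad N S (γ t) j + a • balanceGrad N (γ t) j)ᴴ * γ' j))
      u t := by
  have h1 := hasDerivWithinAt_norm_sq ((hasDerivWithinAt_layerProd N h).const_sub S)
  have h2 := hasDerivWithinAt_sum_norm_sq_balanceError N h
  refine ((h1.const_mul (1 / 2)).fun_add (h2.const_mul (a / 4))).congr_deriv ?_
  simp only [Matrix.conjTranspose_add, Matrix.conjTranspose_smul, add_mul, map_add,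
    Finset.sum_add_distrib]
  congr 1
  · rw [mul_neg, map_neg, Finset.mul_sum, map_sum, mul_neg, mul_neg, ← mul_assoc]
    norm_num
    rw [← Finset.sum_neg_distrib]
    refine Finset.sum_congr rfl fun j _ => ?_
    rw [← mul_assoc, reTr_mul_comm]
    simp [fitGrad, mul_assoc]
  · rw [← mul_assoc, Finset.mul_sum]
    refine Finset.sum_congr rfl fun j _ => ?_
    simp

/-- The gradient is unique, so it is given by the derivative of the loss along the curve that moves
the `j`-th layer only. -/
lemma IsLayerGradient.eq {N : ℕ} {a : ℝ} {S : Matrix (Fin d) (Fin d) 𝕜}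
    {W : ℕ → Matrix (Fin d) (Fin d) 𝕜} {j : ℕ} (hj : j ∈ Finset.Icc 1 N)
    {G : Matrix (Fin d) (Fin d) 𝕜} (hG : IsLayerGradient (loss N a S) W j G) :
    G = fitGrad N S W j + a • balanceGrad N W j := by
  refine eq_of_reTr_conjTranspose_mul_eq fun H => (hG H).unique ?_
  have h : ∀ i ∈ Finset.Icc 1 N, HasDerivWithinAt
      (fun ε : ℝ => Function.update W j (W j + ε • H) i) (if i = j then H else 0) Set.univ 0 := by
    intro i _
    by_cases hij : i = j
    · subst hij
      simp only [Function.update_self, if_true]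
      exact (((hasDerivWithinAt_id (0 : ℝ) Set.univ).smul_const H).const_add (W i)).congr_deriv
        (one_smul _ _)
    · simp only [Function.update_of_ne hij, if_neg hij]
      exact hasDerivWithinAt_const _ _ _
  have := hasDerivWithinAt_loss N a S h
  rw [hasDerivWithinAt_univ] at this
  refine this.congr_deriv ?_
  simp only [zero_smul, add_zero, Function.update_eq_self]
  rw [Finset.sum_eq_single_of_mem j hj]
  · simp
  · intro i _ hij
    simp [hij]

/-! ### Balancedness is preserved by the flow -/

section Flow

variable {N : ℕ} {a : ℝ} {S : Matrix (Fin d) (Fin d) 𝕜} {W : ℝ → ℕ → Matrix (Fin d) (Fin d) 𝕜}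

lemma IsGradientFlow.hasDerivWithinAt_layer (hflow : IsGradientFlow N a S W) {t : ℝ} (ht : 0 ≤ t)
    {j : ℕ} (hj : j ∈ Finset.Icc 1 N) :
    HasDerivWithinAt (fun τ => W τ j) (-(fitGrad N S (W t) j + a • balanceGrad N (W t) j))
      (Set.Ici 0) t := by
  obtain ⟨G, hG, hW⟩ := hflow t ht j hj
  rwa [← hG.eq hj]

lemma layerProd_eq_mul {W : ℕ → Matrix (Fin d) (Fin d) 𝕜} {j : ℕ} (hj : 1 ≤ j) :
    layerProd W j = W j * layerProd W (j - 1) := by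
  obtain ⟨j, rfl⟩ := Nat.exists_eq_add_of_le' hj
  rfl

/-- By this identity the flow of the data-fitting term alone keeps every balance error constant. -/
lemma fitGrad_mul_conjTranspose (N : ℕ) (S : Matrix (Fin d) (Fin d) 𝕜)
    (W : ℕ → Matrix (Fin d) (Fin d) 𝕜) {j : ℕ} (hj : j ∈ Finset.Ico 1 N) :
    fitGrad N S W j * (W j)ᴴ = (W (j + 1))ᴴ * fitGrad N S W (j + 1) := by
  obtain ⟨h1, h2⟩ := Finset.mem_Ico.mp hj
  rw [fitGrad, fitGrad, Nat.add_sub_cancel, upperProd_eq_mul W h2, layerProd_eq_mul h1]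
  simp [mul_assoc]

lemma sum_reTr_balanceGrad_fitGrad (N : ℕ) (S : Matrix (Fin d) (Fin d) 𝕜)
    (W : ℕ → Matrix (Fin d) (Fin d) 𝕜) :
    ∑ j ∈ Finset.Icc 1 N, reTr ((balanceGrad N W j)ᴴ * fitGrad N S W j) = 0 := by
  rw [sum_reTr_balanceGrad]
  refine Finset.sum_eq_zero fun j hj => ?_
  rw [fitGrad_mul_conjTranspose N S W hj, sub_self, mul_zero, map_zero]

/-- The total squared balance error decreases along the flow, so it stays zero. -/
lemma IsGradientFlow.isBalanced (hflow : IsGradientFlow N a S W) (ha : 0 ≤ a)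
    (hbal : IsBalanced N (W 0)) {t : ℝ} (ht : 0 ≤ t) : IsBalanced N (W t) := by
  have hd : ∀ τ ∈ Set.Ici (0 : ℝ), HasDerivWithinAt
      (fun τ => ∑ j ∈ Finset.Ico 1 N, ‖balanceError (W τ) j‖ ^ 2)
      (-(4 * a * ∑ j ∈ Finset.Icc 1 N, ‖balanceGrad N (W τ) j‖ ^ 2)) (Set.Ici 0) τ := by
    intro τ hτ
    refine (hasDerivWithinAt_sum_norm_sq_balanceError N
      fun j hj => hflow.hasDerivWithinAt_layer hτ hj).congr_deriv ?_
    simp only [mul_neg, map_neg, mul_add, map_add, Finset.sum_neg_distrib, Finset.sum_add_distrib,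
      sum_reTr_balanceGrad_fitGrad, mul_smul_comm, map_smul, smul_eq_mul, ← norm_sq_eq_reTr,
      ← Finset.mul_sum]
    ring
  have hanti := antitoneOn_of_hasDerivWithinAt_nonpos (convex_Ici 0)
    (fun τ hτ => (hd τ hτ).continuousWithinAt)
    (fun τ hτ => (hd τ (interior_subset hτ)).mono interior_subset)
    (fun τ _ => neg_nonpos.mpr (by positivity))
  have h0 : ∑ j ∈ Finset.Ico 1 N, ‖balanceError (W t) j‖ ^ 2 ≤ 0 := by
    refine (hanti Set.self_mem_Ici ht ht).trans_eq (Finset.sum_eq_zero fun j hj => ?_)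
    simp [hbal j hj]
  intro j hj
  have := (Finset.sum_eq_zero_iff_of_nonneg fun j _ => by positivity).mp
    (h0.antisymm (Finset.sum_nonneg fun j _ => by positivity)) j hj
  exact norm_eq_zero.mp (by simpa using this)

end Flow

/-! ### Balanced factorizations -/

section Balanced

variable {N : ℕ} {W : ℕ → Matrix (Fin d) (Fin d) 𝕜}

lemma IsBalanced.mul_conjTranspose (hbal : IsBalanced N W) {j : ℕ} (h1 : 1 ≤ j) (h2 : j < N) :
    W j * (W j)ᴴ = (W (j + 1))ᴴ * W (j + 1) :=
  sub_eq_zero.mp (hbal j (Finset.mem_Ico.mpr ⟨h1, h2⟩))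

/-- In a balanced factorization `W_{k+1}ᴴ W_{k+1}` and `W_1ᴴ W_1` are intertwined by
`W_k ⋯ W_1`. -/
lemma IsBalanced.intertwine (hbal : IsBalanced N W) {k : ℕ} (hk : k < N) :
    (W (k + 1))ᴴ * W (k + 1) * layerProd W k = layerProd W k * ((W 1)ᴴ * W 1) := by
  induction k with
  | zero => simp [layerProd]
  | succ k ih =>
    rw [← hbal.mul_conjTranspose (by omega) hk, layerProd, mul_assoc (W (k + 1)), ← mul_assoc _ᴴ,
      ih (by omega), mul_assoc]

lemma IsBalanced.conjTranspose_layerProd_mul (hbal : IsBalanced N W) {k : ℕ} (hk : k ≤ N) :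
    (layerProd W k)ᴴ * layerProd W k = ((W 1)ᴴ * W 1) ^ k := by
  induction k with
  | zero => simp [layerProd]
  | succ k ih =>
    rw [layerProd, Matrix.conjTranspose_mul, mul_assoc, ← mul_assoc _ᴴ (W (k + 1)),
      hbal.intertwine hk, ← mul_assoc, ih (by omega), pow_succ]

lemma mul_pow_conjTranspose_mul (X : Matrix (Fin d) (Fin d) 𝕜) (n : ℕ) :
    X * (Xᴴ * X) ^ n * Xᴴ = (X * Xᴴ) ^ (n + 1) := by
  induction n with
  | zero => simp
  | succ n ih => rw [pow_succ (X * Xᴴ), ← ih, pow_succ]; simp only [mul_assoc]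

lemma IsBalanced.upperProd_mul_conjTranspose (hbal : IsBalanced N W) {j : ℕ} (hj : j ≤ N) :
    upperProd W j N * (upperProd W j N)ᴴ = (W N * (W N)ᴴ) ^ (N - j) := by
  suffices h : ∀ k, k ≤ N → j ≤ k →
      upperProd W j k * (upperProd W j k)ᴴ = (W k * (W k)ᴴ) ^ (k - j) from h N le_rfl hj
  intro k hk hjk
  induction k, hjk using Nat.le_induction with
  | base => simp [upperProd_self]
  | succ k hjk ih =>
    rw [upperProd_succ_right W hjk, Matrix.conjTranspose_mul, mul_assoc, ← mul_assoc _ _ (W (k+1))ᴴ,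
      ih (by omega), Nat.succ_sub hjk]
    rcases k.eq_zero_or_pos with rfl | hk0
    · simp
    · rw [hbal.mul_conjTranspose hk0 hk, ← mul_pow_conjTranspose_mul, mul_assoc]

lemma balanceGrad_eq_zero (hbal : IsBalanced N W) {j : ℕ} (hj : j ∈ Finset.Icc 1 N) :
    balanceGrad N W j = 0 := by
  obtain ⟨h1, h2⟩ := Finset.mem_Icc.mp hj
  unfold balanceGrad
  split_ifs with h3 h4 h4
  · simp [hbal j (by simp; omega), hbal (j - 1) (by simp; omega)]
  · simp [hbal j (by simp; omega)]
  · simp [hbal (j - 1) (by simp; omega)]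
  · simp

/-- Positive semidefinite matrices have unique positive semidefinite `n`-th roots. -/
lemma eq_of_pow_eq_pow {X Y : Matrix (Fin d) (Fin d) 𝕜} (hX : X.PosSemidef) (hY : Y.PosSemidef)
    {n : ℕ} (hn : n ≠ 0) (h : X ^ n = Y ^ n) : X = Y := by
  -- the root is recovered by the real power of the continuous functional calculus
  have key : ∀ Z : Matrix (Fin d) (Fin d) 𝕜, Z.PosSemidef → (Z ^ n) ^ ((n : ℝ)⁻¹) = Z := by
    intro Z hZ
    have hZ' : 0 ≤ Z := hZ.nonneg
    rw [← CFC.rpow_natCast Z n, CFC.rpow_rpow_of_exponent_nonneg Z _ _ (by positivity)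
      (by positivity), mul_inv_cancel₀ (by exact_mod_cast hn), CFC.rpow_one Z]
  rw [← key X hX, h, key Y hY]

end Balanced

/-! ### Singular value decompositions of balanced products -/

lemma conjTranspose_diagMat (s : Fin d → ℝ) : (diagMat 𝕜 s)ᴴ = diagMat 𝕜 s := by
  simp [diagMat, Matrix.diagonal_conjTranspose, Pi.star_def]

lemma diagMat_pow (s : Fin d → ℝ) (n : ℕ) : diagMat 𝕜 s ^ n = diagMat 𝕜 fun i => s i ^ n := by
  simp [diagMat, Matrix.diagonal_pow, Pi.pow_def]

lemma conjTranspose_mul_of_unitary {U : Matrix (Fin d) (Fin d) 𝕜}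
    (hU : U ∈ Matrix.unitaryGroup (Fin d) 𝕜) : Uᴴ * U = 1 :=
  Matrix.mem_unitaryGroup_iff'.mp hU

lemma mul_conjTranspose_of_unitary {U : Matrix (Fin d) (Fin d) 𝕜}
    (hU : U ∈ Matrix.unitaryGroup (Fin d) 𝕜) : U * Uᴴ = 1 :=
  Matrix.mem_unitaryGroup_iff.mp hU

lemma unitary_conj_mul {V X Y U Z : Matrix (Fin d) (Fin d) 𝕜}
    (hV : V ∈ Matrix.unitaryGroup (Fin d) 𝕜) : U * X * Vᴴ * (V * Y * Z) = U * (X * Y) * Z := by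
  calc U * X * Vᴴ * (V * Y * Z) = U * X * (Vᴴ * V) * Y * Z := by simp only [mul_assoc]
    _ = U * (X * Y) * Z := by
      rw [conjTranspose_mul_of_unitary hV, mul_one]; simp only [mul_assoc]

lemma unitary_conj_pow {V X : Matrix (Fin d) (Fin d) 𝕜}
    (hV : V ∈ Matrix.unitaryGroup (Fin d) 𝕜) (n : ℕ) : (V * X * Vᴴ) ^ n = V * X ^ n * Vᴴ := by
  induction n with
  | zero => simp [mul_conjTranspose_of_unitary hV]
  | succ n ih => rw [pow_succ, ih, unitary_conj_mul hV, pow_succ]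

section SVD

variable {N : ℕ} {W : ℕ → Matrix (Fin d) (Fin d) 𝕜} {U V : Matrix (Fin d) (Fin d) 𝕜}
  {s : Fin d → ℝ}

lemma posSemidef_conj_diagMat_sq (V : Matrix (Fin d) (Fin d) 𝕜) (s : Fin d → ℝ) :
    (V * diagMat 𝕜 s ^ 2 * Vᴴ).PosSemidef := by
  have : V * diagMat 𝕜 s ^ 2 * Vᴴ = V * diagMat 𝕜 s * (V * diagMat 𝕜 s)ᴴ := by
    rw [Matrix.conjTranspose_mul, conjTranspose_diagMat, sq]; simp only [mul_assoc]
  rw [this]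
  exact Matrix.posSemidef_self_mul_conjTranspose _

/-- The inner layer of a balanced factorization shares the right singular vectors of the product,
its singular values being their `N`-th roots. -/
lemma IsRootSVD.conjTranspose_mul_first (h : IsRootSVD N (layerProd W N) U s V)
    (hbal : IsBalanced N W) (hN : 0 < N) : (W 1)ᴴ * W 1 = V * diagMat 𝕜 s ^ 2 * Vᴴ := by
  refine eq_of_pow_eq_pow (Matrix.posSemidef_conjTranspose_mul_self _)
    (posSemidef_conj_diagMat_sq V s) hN.ne' ?_
  rw [← hbal.conjTranspose_layerProd_mul le_rfl, h.eq, unitary_conj_pow h.unitary_right, ← pow_mul,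
    Matrix.conjTranspose_mul, Matrix.conjTranspose_mul, Matrix.conjTranspose_conjTranspose,
    Matrix.conjTranspose_pow, conjTranspose_diagMat, ← mul_assoc V, unitary_conj_mul h.unitary_left,
    ← pow_add, two_mul]

/-- The outer layer of a balanced factorization shares the left singular vectors of the product. -/
lemma IsRootSVD.last_mul_conjTranspose (h : IsRootSVD N (layerProd W N) U s V)
    (hbal : IsBalanced N W) (hN : 0 < N) : W N * (W N)ᴴ = U * diagMat 𝕜 s ^ 2 * Uᴴ := by
  refine eq_of_pow_eq_pow (Matrix.posSemidef_self_mul_conjTranspose _)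
    (posSemidef_conj_diagMat_sq U s) hN.ne' ?_
  have := hbal.upperProd_mul_conjTranspose (Nat.zero_le N)
  rw [upperProd_zero, Nat.sub_zero] at this
  rw [← this, h.eq, unitary_conj_pow h.unitary_left, ← pow_mul,
    Matrix.conjTranspose_mul, Matrix.conjTranspose_mul, Matrix.conjTranspose_conjTranspose,
    Matrix.conjTranspose_pow, conjTranspose_diagMat, ← mul_assoc V,
    unitary_conj_mul h.unitary_right, ← pow_add, two_mul]

end SVD

/-! ### Singular values stay positive -/

section Det

/-- Jacobi's formula for the derivative of a determinant. -/
lemma hasDerivWithinAt_det {X : ℝ → Matrix (Fin d) (Fin d) 𝕜} {X' : Matrix (Fin d) (Fin d) 𝕜}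
    {u : Set ℝ} {t : ℝ} (h : HasDerivWithinAt X X' u t) :
    HasDerivWithinAt (fun τ => (X τ).det) (Matrix.trace ((X t).adjugate * X')) u t := by
  have hent : ∀ i j, HasDerivWithinAt (fun τ => X τ i j) (X' i j) u t := fun i j =>
    hasDerivWithinAt_pi.mp (hasDerivWithinAt_pi.mp h i) j
  simp only [Matrix.det_apply']
  have h1 := HasDerivWithinAt.fun_sum fun (σ : Equiv.Perm (Fin d)) (_ : σ ∈ Finset.univ) =>
    (HasDerivWithinAt.fun_finsetProd
      (fun i (_ : i ∈ Finset.univ) => hent (σ i) i)).const_mul ((Equiv.Perm.sign σ : ℤ) : 𝕜)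
  refine h1.congr_deriv ?_
  simp only [Finset.mul_sum]
  rw [Finset.sum_comm, Matrix.trace]
  refine Finset.sum_congr rfl fun i _ => ?_
  -- by Cramer's rule the `i`-th diagonal entry is the determinant of `X` with `i`-th column from `X'`
  have h2 : ((X t).adjugate * X').diag i = ((X t).updateCol i (fun k => X' k i)).det := by
    rw [← Matrix.cramer_apply, Matrix.cramer_eq_adjugate_mulVec]
    rfl
  rw [h2, Matrix.det_apply']
  refine Finset.sum_congr rfl fun σ _ => ?_
  rw [← Finset.mul_prod_erase _ _ (Finset.mem_univ i), Matrix.updateCol_self, smul_eq_mul,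
    mul_comm (X' _ _)]
  congr 2
  refine Finset.prod_congr rfl fun j hj => ?_
  rw [Matrix.updateCol_ne (Finset.ne_of_mem_erase hj)]

end Det

section Flow

variable {N : ℕ} {a : ℝ} {S : Matrix (Fin d) (Fin d) 𝕜} {W : ℝ → ℕ → Matrix (Fin d) (Fin d) 𝕜}

/-- Along balanced layers the penalty does not contribute to the flow. -/
lemma IsGradientFlow.hasDerivWithinAt_layer_of_isBalanced (hflow : IsGradientFlow N a S W) {t : ℝ}
    (ht : 0 ≤ t) (hbal : IsBalanced N (W t)) {j : ℕ} (hj : j ∈ Finset.Icc 1 N) :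
    HasDerivWithinAt (fun τ => W τ j)
      ((upperProd (W t) j N)ᴴ * (S - layerProd (W t) N) * (layerProd (W t) (j - 1))ᴴ)
      (Set.Ici 0) t := by
  refine (hflow.hasDerivWithinAt_layer ht hj).congr_deriv ?_
  rw [balanceGrad_eq_zero hbal hj, smul_zero, add_zero, fitGrad, neg_neg]

lemma IsGradientFlow.hasDerivWithinAt_first (hflow : IsGradientFlow N a S W) (hN : 0 < N) {t : ℝ}
    (ht : 0 ≤ t) (hbal : IsBalanced N (W t)) :
    HasDerivWithinAt (fun τ => (W τ 1)ᴴ * W τ 1)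
      ((layerProd (W t) N)ᴴ * (S - layerProd (W t) N)
        + (S - layerProd (W t) N)ᴴ * layerProd (W t) N) (Set.Ici 0) t := by
  have h := hflow.hasDerivWithinAt_layer_of_isBalanced ht hbal (j := 1) (by simp; omega)
  refine ((hasDerivWithinAt_conjTranspose h).fun_mul h).congr_deriv ?_
  have e : upperProd (W t) 1 N * W t 1 = layerProd (W t) N := by
    rw [← upperProd_zero, upperProd_eq_mul (W t) hN]
  rw [add_comm, ← e]
  simp [layerProd, mul_assoc]

lemma IsGradientFlow.hasDerivWithinAt_last (hflow : IsGradientFlow N a S W) (hN : 0 < N) {t : ℝ}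
    (ht : 0 ≤ t) (hbal : IsBalanced N (W t)) :
    HasDerivWithinAt (fun τ => W τ N * (W τ N)ᴴ)
      ((S - layerProd (W t) N) * (layerProd (W t) N)ᴴ
        + layerProd (W t) N * (S - layerProd (W t) N)ᴴ) (Set.Ici 0) t := by
  have h := hflow.hasDerivWithinAt_layer_of_isBalanced ht hbal (j := N) (by simp; omega)
  refine (h.fun_mul (hasDerivWithinAt_conjTranspose h)).congr_deriv ?_
  rw [upperProd_self]
  have e := layerProd_eq_mul (W := W t) (j := N) hN
  generalize layerProd (W t) N = L at *
  subst e
  simp [mul_assoc]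

/-- Balanced layers make the product itself follow an autonomous differential equation. -/
lemma IsGradientFlow.hasDerivWithinAt_layerProd (hflow : IsGradientFlow N a S W) {t : ℝ}
    (ht : 0 ≤ t) (hbal : IsBalanced N (W t)) :
    HasDerivWithinAt (fun τ => layerProd (W τ) N)
      (∑ i ∈ Finset.range N, (W t N * (W t N)ᴴ) ^ i * (S - layerProd (W t) N)
        * ((W t 1)ᴴ * W t 1) ^ (N - 1 - i)) (Set.Ici 0) t := by
  refine (DeepMF.hasDerivWithinAt_layerProd N fun j hj =>
    hflow.hasDerivWithinAt_layer_of_isBalanced ht hbal hj).congr_deriv ?_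
  have e : Finset.Icc 1 N = Finset.Ico (0 + 1) (N + 1) := by ext; simp
  rw [← Finset.sum_range_reflect, Finset.range_eq_Ico, e, ← Finset.sum_Ico_add']
  refine Finset.sum_congr rfl fun j hj => ?_
  have hj' : j < N := (Finset.mem_Ico.mp hj).2
  rw [show N - 1 - (N - 1 - j) = j by omega, show N - 1 - j = N - (j + 1) by omega,
    ← hbal.upperProd_mul_conjTranspose hj', ← hbal.conjTranspose_layerProd_mul hj'.le]
  simp only [Nat.add_sub_cancel, mul_assoc]

variable {U V : ℝ → Matrix (Fin d) (Fin d) 𝕜} {s : ℝ → Fin d → ℝ}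

lemma det_conj_diagMat_sq {V : Matrix (Fin d) (Fin d) 𝕜} (hV : V ∈ Matrix.unitaryGroup (Fin d) 𝕜)
    (s : Fin d → ℝ) : (V * diagMat 𝕜 s ^ 2 * Vᴴ).det = ((∏ i, s i ^ 2 : ℝ) : 𝕜) := by
  rw [Matrix.det_mul_right_comm, mul_conjTranspose_of_unitary hV, one_mul, diagMat_pow, diagMat,
    Matrix.det_diagonal]
  push_cast
  rfl

/-- The determinant `f = ∏ sᵢ²` of `W_1ᴴ W_1` satisfies `f' = c f` with a locally bounded `c`, so it
cannot reach zero in finite time. -/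
lemma IsGradientFlow.singularValue_pos (hflow : IsGradientFlow N a S W) (hN : 2 ≤ N)
    (hbal : ∀ t, 0 ≤ t → IsBalanced N (W t))
    (hsvd : ∀ t : ℝ, 0 ≤ t → IsRootSVD N (layerProd (W t) N) (U t) (s t) (V t))
    (hs0 : ∀ i, s 0 i ≠ 0) {t : ℝ} (ht : 0 ≤ t) (i : Fin d) : 0 < s t i := by
  set f : ℝ → ℝ := fun τ => ∏ i, s τ i ^ 2 with hf
  set K : ℝ → Matrix (Fin d) (Fin d) 𝕜 := fun τ => V τ * diagMat 𝕜 (s τ) ^ (N - 2) * (U τ)ᴴ with hK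
  set E : ℝ → Matrix (Fin d) (Fin d) 𝕜 := fun τ => S - layerProd (W τ) N with hE
  have hA : ∀ τ, 0 ≤ τ → (W τ 1)ᴴ * W τ 1 = V τ * diagMat 𝕜 (s τ) ^ 2 * (V τ)ᴴ := fun τ hτ =>
    (hsvd τ hτ).conjTranspose_mul_first (hbal τ hτ) (by omega)
  have hdet : ∀ τ, 0 ≤ τ → ((W τ 1)ᴴ * W τ 1).det = (f τ : 𝕜) := fun τ hτ => by
    rw [hA τ hτ, det_conj_diagMat_sq (hsvd τ hτ).unitary_right]
  -- `K` is bounded because `N ≥ 2`, and it factors `Wᴴ` through `W_1ᴴ W_1` without inverting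
  have hLK : ∀ τ, 0 ≤ τ → (layerProd (W τ) N)ᴴ = ((W τ 1)ᴴ * W τ 1) * K τ := by
    intro τ hτ
    rw [hA τ hτ, hK, unitary_conj_mul (hsvd τ hτ).unitary_right, ← pow_add,
      show 2 + (N - 2) = N by omega, (hsvd τ hτ).eq]
    simp [conjTranspose_diagMat, mul_assoc]
  have hderiv : ∀ τ, 0 ≤ τ →
      HasDerivWithinAt f (f τ * (2 * reTr (K τ * E τ))) (Set.Ici 0) τ := by
    intro τ hτ
    have h1 := hasDerivWithinAt_det
      (hflow.hasDerivWithinAt_first (by omega) hτ (hbal τ hτ))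
    have h2 := (RCLike.reCLM (K := 𝕜)).hasFDerivAt.comp_hasDerivWithinAt τ h1
    refine (h2.congr (fun x hx => ?_) ?_).congr_deriv ?_
    · simp only [Function.comp_apply, hdet x hx, RCLike.reCLM_apply, RCLike.ofReal_re]
    · simp only [Function.comp_apply, hdet τ hτ, RCLike.reCLM_apply, RCLike.ofReal_re]
    · have e1 : ((W τ 1)ᴴ * W τ 1).adjugate * ((layerProd (W τ) N)ᴴ * E τ) =
          (f τ : 𝕜) • (K τ * E τ) := by
        rw [hLK τ hτ, mul_assoc _ (K τ), ← mul_assoc, Matrix.adjugate_mul, hdet τ hτ, smul_mul_assoc,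
          one_mul]
      have e2 : Matrix.trace (((W τ 1)ᴴ * W τ 1).adjugate * ((E τ)ᴴ * layerProd (W τ) N)) =
          (f τ : 𝕜) * Matrix.trace ((K τ * E τ)ᴴ) := by
        have : layerProd (W τ) N = (K τ)ᴴ * ((W τ 1)ᴴ * W τ 1) := by
          rw [← Matrix.conjTranspose_conjTranspose (layerProd (W τ) N), hLK τ hτ]
          simp
        rw [this, ← mul_assoc _ (K τ)ᴴ, ← mul_assoc, Matrix.trace_mul_comm, ← mul_assoc,
          Matrix.mul_adjugate, hdet τ hτ, smul_mul_assoc, one_mul, Matrix.trace_smul, smul_eq_mul,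
          Matrix.conjTranspose_mul (K τ)]
      have e3 := reTr_conjTranspose (K τ * E τ)
      simp only [reTr_apply] at e3 ⊢
      rw [mul_add, Matrix.trace_add, e1, e2, Matrix.trace_smul]
      simp only [RCLike.reCLM_apply, map_add, smul_eq_mul, RCLike.re_ofReal_mul, e3]
      ring
  -- `K` itself need not be continuous in time, but its norm is
  have hnormK : ∀ τ, 0 ≤ τ → ‖K τ‖ = √(reTr ((W τ N * (W τ N)ᴴ) ^ (N - 2))) := by
    intro τ hτ
    rw [← Real.sqrt_sq (norm_nonneg (K τ)), norm_sq_eq_reTr,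
      (hsvd τ hτ).last_mul_conjTranspose (hbal τ hτ) (by omega),
      unitary_conj_pow (hsvd τ hτ).unitary_left, hK]
    simp only [Matrix.conjTranspose_mul, Matrix.conjTranspose_pow, conjTranspose_diagMat,
      Matrix.conjTranspose_conjTranspose]
    rw [← mul_assoc (U τ), unitary_conj_mul (hsvd τ hτ).unitary_right, ← pow_add, ← pow_mul,
      two_mul]
  have hsub : Set.Icc 0 t ⊆ Set.Ici 0 := Set.Icc_subset_Ici_self
  obtain ⟨C, hC⟩ : ∃ C, ∀ τ ∈ Set.Icc 0 t, |2 * reTr (K τ * E τ)| ≤ C := by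
    have hc : ContinuousOn (fun τ => 2 * (√(reTr ((W τ N * (W τ N)ᴴ) ^ (N - 2))) * ‖E τ‖))
        (Set.Icc 0 t) := by
      intro τ hτ
      have hB := ((hflow.hasDerivWithinAt_last (by omega) hτ.1
        (hbal τ hτ.1)).continuousWithinAt.mono hsub)
      have hL := ((hflow.hasDerivWithinAt_layerProd hτ.1
        (hbal τ hτ.1)).continuousWithinAt.mono hsub)
      have h1 : ContinuousWithinAt (fun τ => reTr ((W τ N * (W τ N)ᴴ) ^ (N - 2))) (Set.Icc 0 t) τ :=
        reTr.continuous.continuousAt.comp_continuousWithinAt (hB.pow (N - 2))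
      exact continuousWithinAt_const.mul (h1.sqrt.mul (continuousWithinAt_const.sub hL).norm)
    obtain ⟨C, hC⟩ := isCompact_Icc.exists_bound_of_continuousOn hc
    refine ⟨C, fun τ hτ => le_trans ?_ ((le_abs_self _).trans (hC τ hτ))⟩
    rw [← hnormK τ hτ.1, abs_mul, abs_two]
    gcongr
    exact abs_reTr_mul_le _ _
  -- with `f' ≥ -C f`, the function `f exp (C τ)` cannot decrease
  have hmono : MonotoneOn (fun τ => f τ * Real.exp (C * τ)) (Set.Icc 0 t) := by
    have hd : ∀ τ ∈ Set.Icc 0 t, HasDerivWithinAt (fun τ => f τ * Real.exp (C * τ))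
        (f τ * (2 * reTr (K τ * E τ) + C) * Real.exp (C * τ)) (Set.Icc 0 t) τ := by
      intro τ hτ
      have h1 := (hderiv τ hτ.1).mono hsub
      have h2 := (((hasDerivAt_id τ).const_mul C).exp).hasDerivWithinAt (s := Set.Icc 0 t)
      refine (h1.fun_mul h2).congr_deriv ?_
      simp only [id]
      ring
    refine monotoneOn_of_hasDerivWithinAt_nonneg (convex_Icc 0 t)
      (fun τ hτ => (hd τ hτ).continuousWithinAt)
      (fun τ hτ => (hd τ (interior_subset hτ)).mono interior_subset) fun τ hτ => ?_
    have h1 := neg_le_of_abs_le (hC τ (interior_subset hτ))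
    have h2 : 0 ≤ f τ := Finset.prod_nonneg fun i _ => sq_nonneg _
    have h3 : 0 ≤ 2 * reTr (K τ * E τ) + C := by linarith
    positivity
  have hf0 : 0 < f 0 := Finset.prod_pos fun i _ => by have := hs0 i; positivity
  have hft : f t ≠ 0 := by
    have := hmono ⟨le_rfl, ht⟩ ⟨ht, le_rfl⟩ ht
    intro h
    simp only [mul_zero, Real.exp_zero, mul_one, h, zero_mul] at this
    linarith
  have := Finset.prod_ne_zero_iff.mp hft i (Finset.mem_univ i)
  exact lt_of_le_of_ne ((hsvd t ht).nonneg i) fun h => this (by rw [← h]; simp)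

end Flow

/-! ### The velocity of `U Σ_w² Vᴴ` -/

/-- The derivative of `U Σ_w² Vᴴ` along the flow, expressed in the frames `U`, `V`: here
`P = Σ_w²`, `Q = Uᴴ S V`, `Q' = Qᴴ` and `N = 2 k + 2`. -/
def crossVelocity {R : Type*} [Ring R] (k : ℕ) (P Q Q' : R) : R :=
  Q * P ^ (k + 1) + P ^ (k + 1) * Q - 2 • (P ^ (k + 1) * P ^ (k + 1))
    + ∑ i ∈ Finset.range k, P ^ (i + 1) * (Q - Q') * P ^ (k - i)

/-- The identity behind the formula for `crossVelocity`: differentiating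
`(U Σ_w² Vᴴ) (V Σ_w² Vᴴ)^k = W` gives a linear equation for the velocity of `U Σ_w² Vᴴ`, which
`crossVelocity` solves without inverting `P`. -/
lemma crossVelocity_mul_pow_add {R : Type*} [Ring R] (k : ℕ) (P Q Q' : R) :
    crossVelocity k P Q Q' * P ^ k
        + P * ∑ i ∈ Finset.range k, P ^ i * (P ^ (k + 1) * (Q - P ^ (k + 1))
            + (Q' - P ^ (k + 1)) * P ^ (k + 1)) * P ^ (k - 1 - i) =
      ∑ i ∈ Finset.range (2 * k + 2), P ^ i * (Q - P ^ (k + 1)) * P ^ (2 * k + 1 - i) := by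
  -- the terms in `Q'` cancel, and those in `Q` fill the two halves of the sum on the right,
  -- except for the exponents `0` and `k + 1` that come from the first terms of `crossVelocity`
  have term : ∀ i ∈ Finset.range k, P ^ (i + 1) * (Q - Q') * P ^ (k - i) * P ^ k
      + P * (P ^ i * (P ^ (k + 1) * (Q - P ^ (k + 1))
          + (Q' - P ^ (k + 1)) * P ^ (k + 1)) * P ^ (k - 1 - i)) =
      P ^ (i + 1) * (Q - P ^ (k + 1)) * P ^ (2 * k + 1 - (i + 1))
        + P ^ (k + 1 + (i + 1)) * (Q - P ^ (k + 1)) * P ^ (2 * k + 1 - (k + 1 + (i + 1))) := by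
    intro i hi
    obtain ⟨m, rfl⟩ := Nat.exists_eq_add_of_lt (Finset.mem_range.mp hi)
    rw [show i + m + 1 - i = m + 1 by omega, show i + m + 1 - 1 - i = m by omega,
      show 2 * (i + m + 1) + 1 - (i + 1) = (m + 1) + (i + m + 1) by omega,
      show 2 * (i + m + 1) + 1 - (i + m + 1 + 1 + (i + 1)) = m by omega]
    rw [← mul_assoc P, ← mul_assoc P, ← pow_succ']
    simp only [mul_sub, sub_mul, mul_add, add_mul, mul_assoc, ← pow_add]
    simp only [← mul_assoc, ← pow_add]
    rw [show i + m + 1 + 1 + m = m + 1 + (i + m + 1) by omega,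
      show i + 1 + (i + m + 1 + 1) = i + m + 1 + 1 + (i + 1) by omega,
      show i + m + 1 + 1 + (i + 1) + (i + m + 1 + 1) + m
        = i + 1 + (i + m + 1 + 1) + (m + 1 + (i + m + 1)) by omega]
    abel_nf
  rw [Finset.mul_sum, crossVelocity, add_mul, Finset.sum_mul, add_assoc, ← Finset.sum_add_distrib,
    Finset.sum_congr rfl term, Finset.sum_add_distrib, show 2 * k + 2 = (k + 1) + (k + 1) by omega,
    Finset.sum_range_add, Finset.sum_range_succ' _ k, Finset.sum_range_succ' _ k,
    show 2 * k + 1 - (k + 1 + 0) = k by omega, show 2 * k + 1 - 0 = (k + 1) + k by omega]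
  simp only [mul_sub, sub_mul, add_mul, two_smul, pow_zero, one_mul, add_zero, mul_assoc, ← pow_add]
  rw [show k + 1 + (k + 1 + k) = k + 1 + (k + 1) + k by omega]
  abel

lemma sum_range_pow_mul_pow_reflect {R : Type*} [Ring R] (k : ℕ) (P M : R) :
    ∑ i ∈ Finset.range k, P ^ (k.pred - i) * M * P ^ i =
      ∑ i ∈ Finset.range k, P ^ i * M * P ^ (k - 1 - i) := by
  rw [← Finset.sum_range_reflect]
  refine Finset.sum_congr rfl fun i hi => ?_
  rw [Nat.pred_eq_sub_one, Nat.sub_sub_self (Nat.le_sub_one_of_lt (Finset.mem_range.mp hi))]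

/-- The linear equation of `crossVelocity_mul_pow_add` in the frames `U`, `V`. -/
lemma unitary_conj_crossVelocity {U V : Matrix (Fin d) (Fin d) 𝕜}
    (hU : U ∈ Matrix.unitaryGroup (Fin d) 𝕜) (hV : V ∈ Matrix.unitaryGroup (Fin d) 𝕜) (k : ℕ)
    (P Q Q' : Matrix (Fin d) (Fin d) 𝕜) :
    U * crossVelocity k P Q Q' * Vᴴ * (V * P * Vᴴ) ^ k
        + U * P * Vᴴ * ∑ i ∈ Finset.range k, (V * P * Vᴴ) ^ (k.pred - i)
          * (V * P ^ (k + 1) * Uᴴ * (U * (Q - P ^ (k + 1)) * Vᴴ)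
            + V * (Q' - P ^ (k + 1)) * Uᴴ * (U * P ^ (k + 1) * Vᴴ)) * (V * P * Vᴴ) ^ i =
      ∑ i ∈ Finset.range (2 * k + 2), (U * P * Uᴴ) ^ i * (U * (Q - P ^ (k + 1)) * Vᴴ)
        * (V * P * Vᴴ) ^ (2 * k + 2 - 1 - i) := by
  have e1 : ∀ i j, (V * P * Vᴴ) ^ i * (V * P ^ (k + 1) * Uᴴ * (U * (Q - P ^ (k + 1)) * Vᴴ)
        + V * (Q' - P ^ (k + 1)) * Uᴴ * (U * P ^ (k + 1) * Vᴴ)) * (V * P * Vᴴ) ^ j =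
      V * (P ^ i * (P ^ (k + 1) * (Q - P ^ (k + 1)) + (Q' - P ^ (k + 1)) * P ^ (k + 1)) * P ^ j)
        * Vᴴ := by
    intro i j
    rw [unitary_conj_pow hV, unitary_conj_pow hV, unitary_conj_mul hU, unitary_conj_mul hU,
      ← add_mul, ← mul_add, unitary_conj_mul hV, unitary_conj_mul hV]
  have e2 : ∀ i j, (U * P * Uᴴ) ^ i * (U * (Q - P ^ (k + 1)) * Vᴴ) * (V * P * Vᴴ) ^ j =
      U * (P ^ i * (Q - P ^ (k + 1)) * P ^ j) * Vᴴ := by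
    intro i j
    rw [unitary_conj_pow hU, unitary_conj_pow hV, unitary_conj_mul hU, unitary_conj_mul hV]
  rw [Finset.sum_congr rfl fun i _ => e1 _ _, Finset.sum_congr rfl fun i _ => e2 _ _,
    ← Finset.sum_mul, ← Finset.sum_mul, ← Finset.mul_sum, ← Finset.mul_sum, unitary_conj_pow hV,
    unitary_conj_mul hV, unitary_conj_mul hV, ← add_mul, ← mul_add,
    show 2 * k + 2 - 1 = 2 * k + 1 from rfl, ← crossVelocity_mul_pow_add k P Q Q',
    sum_range_pow_mul_pow_reflect]

section Deriv

variable {L M : ℝ → Matrix (Fin d) (Fin d) 𝕜} {L' M' D : Matrix (Fin d) (Fin d) 𝕜}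
  {u : Set ℝ} {t : ℝ}

/-- The quotient rule for `L M⁻¹`, with the derivative characterized by the product rule. -/
lemma hasDerivWithinAt_mul_ringInverse (hL : HasDerivWithinAt L L' u t)
    (hM : HasDerivWithinAt M M' u t) (hunit : IsUnit (M t))
    (hD : D * M t + L t * Ring.inverse (M t) * M' = L') :
    HasDerivWithinAt (fun τ => L τ * Ring.inverse (M τ)) D u t := by
  obtain ⟨m, hm⟩ := hunit
  have h1 : HasDerivWithinAt (fun τ => Ring.inverse (M τ))
      (-((m⁻¹ : (Matrix (Fin d) (Fin d) 𝕜)ˣ) * M' * (m⁻¹ : (Matrix (Fin d) (Fin d) 𝕜)ˣ))) u t := by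
    have := hasFDerivAt_ringInverse (𝕜 := ℝ) m
    rw [hm] at this
    exact (this.comp_hasDerivWithinAt t hM).congr_deriv (by simp)
  refine (hL.fun_mul h1).congr_deriv ?_
  rw [← hD, ← hm, Ring.inverse_unit]
  simp [add_mul, mul_assoc]

end Deriv

section Flow

variable {N : ℕ} {a : ℝ} {S : Matrix (Fin d) (Fin d) 𝕜} {W : ℝ → ℕ → Matrix (Fin d) (Fin d) 𝕜}
  {U V : ℝ → Matrix (Fin d) (Fin d) 𝕜} {s : ℝ → Fin d → ℝ}

lemma isUnit_conj_diagMat_sq {V : Matrix (Fin d) (Fin d) 𝕜}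
    (hV : V ∈ Matrix.unitaryGroup (Fin d) 𝕜) {s : Fin d → ℝ} (hs : ∀ i, 0 < s i) :
    IsUnit (V * diagMat 𝕜 s ^ 2 * Vᴴ) := by
  rw [Matrix.isUnit_iff_isUnit_det, det_conj_diagMat_sq hV, isUnit_iff_ne_zero]
  exact_mod_cast (Finset.prod_pos fun i _ => pow_pos (hs i) 2).ne'

/-- Although `U` and `V` need not be continuous, `U Σ_w² Vᴴ = W (W_1ᴴ W_1)^{-k}` is
differentiable. -/
lemma IsGradientFlow.hasDerivWithinAt_cross (hflow : IsGradientFlow N a S W) {k : ℕ}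
    (hN : N = 2 * k + 2) (hS : Sᴴ = S) (hbal : ∀ t, 0 ≤ t → IsBalanced N (W t))
    (hsvd : ∀ t : ℝ, 0 ≤ t → IsRootSVD N (layerProd (W t) N) (U t) (s t) (V t))
    (hpos : ∀ t, 0 ≤ t → ∀ i, 0 < s t i) {t : ℝ} (ht : 0 ≤ t) :
    HasDerivWithinAt (fun τ => U τ * diagMat 𝕜 (s τ) ^ 2 * (V τ)ᴴ)
      (U t * crossVelocity k (diagMat 𝕜 (s t) ^ 2) ((U t)ᴴ * S * V t) ((V t)ᴴ * S * U t) * (V t)ᴴ)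
      (Set.Ici 0) t := by
  have hA : ∀ τ, 0 ≤ τ → (W τ 1)ᴴ * W τ 1 = V τ * diagMat 𝕜 (s τ) ^ 2 * (V τ)ᴴ := fun τ hτ =>
    (hsvd τ hτ).conjTranspose_mul_first (hbal τ hτ) (by omega)
  have hunit : ∀ τ, 0 ≤ τ → IsUnit (((W τ 1)ᴴ * W τ 1) ^ k) := fun τ hτ => by
    rw [hA τ hτ]
    exact (isUnit_conj_diagMat_sq (hsvd τ hτ).unitary_right (hpos τ hτ)).pow k
  have hcross : ∀ τ, 0 ≤ τ → U τ * diagMat 𝕜 (s τ) ^ 2 * (V τ)ᴴ =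
      layerProd (W τ) N * Ring.inverse (((W τ 1)ᴴ * W τ 1) ^ k) := by
    intro τ hτ
    have h1 : layerProd (W τ) N =
        U τ * diagMat 𝕜 (s τ) ^ 2 * (V τ)ᴴ * ((W τ 1)ᴴ * W τ 1) ^ k := by
      rw [hA τ hτ, unitary_conj_pow (hsvd τ hτ).unitary_right,
        unitary_conj_mul (hsvd τ hτ).unitary_right, ← pow_mul, ← pow_add, (hsvd τ hτ).eq]
      congr 3
      omega
    rw [h1, mul_assoc _ (_ ^ k), Ring.mul_inverse_cancel _ (hunit τ hτ), mul_one]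
  have hB := (hsvd t ht).last_mul_conjTranspose (hbal t ht) (by omega)
  have hU := (hsvd t ht).unitary_left
  have hV := (hsvd t ht).unitary_right
  refine HasDerivWithinAt.congr (hasDerivWithinAt_mul_ringInverse
    (hflow.hasDerivWithinAt_layerProd ht (hbal t ht))
    ((hflow.hasDerivWithinAt_first (by omega) ht (hbal t ht)).fun_pow' k)
    (hunit t ht) ?_) (fun τ hτ => hcross τ hτ) (hcross t ht)
  rw [← hcross t ht, hA t ht, hB]
  set P := diagMat 𝕜 (s t) ^ 2 with hP
  set Q := (U t)ᴴ * S * V t with hQ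
  set Q' := (V t)ᴴ * S * U t with hQ'
  have hPN : diagMat 𝕜 (s t) ^ N = P ^ (k + 1) := by
    rw [hP, ← pow_mul, hN]; congr 1
  have hPH : (P ^ (k + 1))ᴴ = P ^ (k + 1) := by
    simp [hP, conjTranspose_diagMat]
  have hL : layerProd (W t) N = U t * P ^ (k + 1) * (V t)ᴴ := by rw [(hsvd t ht).eq, hPN]
  have hLH : (layerProd (W t) N)ᴴ = V t * P ^ (k + 1) * (U t)ᴴ := by
    rw [hL, Matrix.conjTranspose_mul, Matrix.conjTranspose_mul, hPH,
      Matrix.conjTranspose_conjTranspose, mul_assoc]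
  have hE : S - layerProd (W t) N = U t * (Q - P ^ (k + 1)) * (V t)ᴴ := by
    have : U t * Q * (V t)ᴴ = S := by
      calc U t * Q * (V t)ᴴ = (U t * (U t)ᴴ) * S * (V t * (V t)ᴴ) := by
            simp only [hQ, mul_assoc]
        _ = S := by
            rw [mul_conjTranspose_of_unitary hU, mul_conjTranspose_of_unitary hV, one_mul, mul_one]
    rw [mul_sub, sub_mul, this, hL]
  have hEH : (S - layerProd (W t) N)ᴴ = V t * (Q' - P ^ (k + 1)) * (U t)ᴴ := by
    have hQH : Qᴴ = Q' := by
      simp [hQ, hQ', hS, mul_assoc]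
    rw [hE, Matrix.conjTranspose_mul, Matrix.conjTranspose_mul, Matrix.conjTranspose_sub, hPH, hQH,
      Matrix.conjTranspose_conjTranspose, mul_assoc]
  rw [hEH, hLH, hE, hL]
  rw [hN]
  exact unitary_conj_crossVelocity hU hV k P Q Q'

end Flow

/-! ### The skew-Hermitian error and its rate -/

lemma reTr_mul_conj_symm {M U V X : Matrix (Fin d) (Fin d) 𝕜} (hM : Mᴴ = M) (hX : Xᴴ = X) :
    reTr (M * (V * X * Uᴴ)) = reTr (M * (U * X * Vᴴ)) := by
  rw [← reTr_conjTranspose, reTr_mul_comm M (U * X * Vᴴ)]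
  simp [hM, hX, mul_assoc]

/-- Expansion of the three squared norms that occur in the error and its rate. -/
lemma norm_sq_mul_sub_mul_diagMat {T U V : Matrix (Fin d) (Fin d) 𝕜} (hT : Tᴴ = T)
    (s : Fin d → ℝ) (m : ℕ) :
    ‖T * (U - V) * diagMat 𝕜 s ^ m‖ ^ 2 =
      reTr (T * T * (U * diagMat 𝕜 s ^ (2 * m) * Uᴴ))
        + reTr (T * T * (V * diagMat 𝕜 s ^ (2 * m) * Vᴴ))
        - 2 * reTr (T * T * (U * diagMat 𝕜 s ^ (2 * m) * Vᴴ)) := by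
  have hX : (diagMat 𝕜 s ^ (2 * m))ᴴ = diagMat 𝕜 s ^ (2 * m) := by simp [conjTranspose_diagMat]
  have hTT : (T * T)ᴴ = T * T := by simp [hT]
  have h1 : reTr ((T * (U - V) * diagMat 𝕜 s ^ m)ᴴ * (T * (U - V) * diagMat 𝕜 s ^ m)) =
      reTr (T * T * ((U - V) * diagMat 𝕜 s ^ (2 * m) * (U - V)ᴴ)) := by
    rw [reTr_mul_comm, mul_assoc T T, reTr_mul_comm T]
    simp [hT, conjTranspose_diagMat, two_mul, pow_add, mul_assoc]
  rw [norm_sq_eq_reTr, h1]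
  have h2 := reTr_mul_conj_symm (U := U) (V := V) hTT hX
  simp only [Matrix.conjTranspose_sub, sub_mul, mul_sub, map_sub, h2]
  ring

lemma conjTranspose_sqrt {S : Matrix (Fin d) (Fin d) 𝕜} : (CFC.sqrt S)ᴴ = CFC.sqrt S :=
  (Matrix.nonneg_iff_posSemidef.mp (CFC.sqrt_nonneg S)).isHermitian

lemma sqrt_mul_sqrt {S : Matrix (Fin d) (Fin d) 𝕜} (hS : S.PosSemidef) :
    CFC.sqrt S * CFC.sqrt S = S :=
  CFC.sqrt_mul_sqrt_self S hS.nonneg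

lemma skewError_eq {S : Matrix (Fin d) (Fin d) 𝕜} (hS : S.PosSemidef)
    (U V : Matrix (Fin d) (Fin d) 𝕜) (s : Fin d → ℝ) :
    skewError S U s V = reTr (S * (U * diagMat 𝕜 s ^ 2 * Uᴴ))
      + reTr (S * (V * diagMat 𝕜 s ^ 2 * Vᴴ)) - 2 * reTr (S * (U * diagMat 𝕜 s ^ 2 * Vᴴ)) := by
  have := norm_sq_mul_sub_mul_diagMat (U := U) (V := V) (conjTranspose_sqrt (S := S)) s 1
  rwa [pow_one, sqrt_mul_sqrt hS] at this

/-- The third term of the rate is the part of `crossVelocity` that involves `Q - Qᴴ`. -/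
lemma reTr_mul_crossVelocity {S U V : Matrix (Fin d) (Fin d) 𝕜}
    (hU : U ∈ Matrix.unitaryGroup (Fin d) 𝕜) (hV : V ∈ Matrix.unitaryGroup (Fin d) 𝕜)
    (s : Fin d → ℝ) {k N : ℕ} (hN : N = 2 * k + 2) :
    reTr (S * (U * crossVelocity k (diagMat 𝕜 s ^ 2) (Uᴴ * S * V) (Vᴴ * S * U) * Vᴴ)) =
      reTr (S * S * (V * diagMat 𝕜 s ^ N * Vᴴ)) + reTr (S * S * (U * diagMat 𝕜 s ^ N * Uᴴ))
        - 2 * reTr (S * (U * diagMat 𝕜 s ^ (2 * N) * Vᴴ))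
        + reTr (∑ j ∈ Finset.Icc 1 (N / 2 - 1), S * U * diagMat 𝕜 s ^ (2 * j)
            * (Uᴴ * S * V - Vᴴ * S * U) * diagMat 𝕜 s ^ (N - 2 * j) * Vᴴ) := by
  have hP : (diagMat 𝕜 s ^ 2) ^ (k + 1) = diagMat 𝕜 s ^ N := by
    rw [← pow_mul, hN]; congr 1
  have e1 : S * (U * (Uᴴ * S * V * diagMat 𝕜 s ^ N) * Vᴴ) =
      S * S * (V * diagMat 𝕜 s ^ N * Vᴴ) := by
    calc _ = S * (U * Uᴴ) * S * (V * diagMat 𝕜 s ^ N * Vᴴ) := by simp only [mul_assoc]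
      _ = _ := by rw [mul_conjTranspose_of_unitary hU, mul_one]
  have e2 : reTr (S * (U * (diagMat 𝕜 s ^ N * (Uᴴ * S * V)) * Vᴴ)) =
      reTr (S * S * (U * diagMat 𝕜 s ^ N * Uᴴ)) := by
    rw [mul_assoc S S, reTr_mul_comm S (S * _)]
    congr 1
    calc _ = S * (U * diagMat 𝕜 s ^ N * Uᴴ) * S * (V * Vᴴ) := by simp only [mul_assoc]
      _ = _ := by rw [mul_conjTranspose_of_unitary hV, mul_one]
  have e3 : ∑ j ∈ Finset.Icc 1 (N / 2 - 1), S * U * diagMat 𝕜 s ^ (2 * j)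
        * (Uᴴ * S * V - Vᴴ * S * U) * diagMat 𝕜 s ^ (N - 2 * j) * Vᴴ =
      S * (U * (∑ i ∈ Finset.range k, (diagMat 𝕜 s ^ 2) ^ (i + 1)
        * (Uᴴ * S * V - Vᴴ * S * U) * (diagMat 𝕜 s ^ 2) ^ (k - i)) * Vᴴ) := by
    -- `j = i + 1`
    have hI : Finset.Icc 1 (N / 2 - 1) = Finset.Ico (0 + 1) (k + 1) := by
      ext; simp; omega
    rw [hI, ← Finset.sum_Ico_add', ← Finset.range_eq_Ico, Finset.mul_sum, Finset.sum_mul,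
      Finset.mul_sum]
    refine Finset.sum_congr rfl fun i _ => ?_
    rw [← pow_mul, ← pow_mul, show N - 2 * (i + 1) = 2 * (k - i) by omega]
    simp only [mul_assoc]
  rw [e3, crossVelocity, hP, ← pow_add, ← two_mul]
  simp only [mul_add, add_mul, mul_sub, sub_mul, map_add, map_sub, e1, e2, two_smul]
  ring

/-- The derivatives of `U Σ_w² Uᴴ`, `V Σ_w² Vᴴ` and `U Σ_w² Vᴴ` combine to the claimed rate. -/
lemma skewErrorRate_eq {S U V L : Matrix (Fin d) (Fin d) 𝕜} {s : Fin d → ℝ} {N k : ℕ}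
    (hS : S.PosSemidef) (hL : IsRootSVD N L U s V) (hN : N = 2 * k + 2) :
    skewErrorRate N S U s V =
      reTr (S * ((S - L) * Lᴴ + L * (S - L)ᴴ)) + reTr (S * (Lᴴ * (S - L) + (S - L)ᴴ * L))
        - 2 * reTr (S * (U * crossVelocity k (diagMat 𝕜 s ^ 2) (Uᴴ * S * V) (Vᴴ * S * U) * Vᴴ)) := by
  have hSH : Sᴴ = S := hS.isHermitian
  have hD : (diagMat 𝕜 s ^ N)ᴴ = diagMat 𝕜 s ^ N := by simp [conjTranspose_diagMat]
  have hLH : Lᴴ = V * diagMat 𝕜 s ^ N * Uᴴ := by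
    rw [hL.eq, Matrix.conjTranspose_mul, Matrix.conjTranspose_mul, hD,
      Matrix.conjTranspose_conjTranspose, mul_assoc]
  have hLL : L * Lᴴ = U * diagMat 𝕜 s ^ (2 * N) * Uᴴ := by
    rw [hLH, hL.eq, unitary_conj_mul hL.unitary_right, ← pow_add, two_mul]
  have hLL' : Lᴴ * L = V * diagMat 𝕜 s ^ (2 * N) * Vᴴ := by
    rw [hLH, hL.eq, unitary_conj_mul hL.unitary_left, ← pow_add, two_mul]
  have a1 : reTr (S * (S * Lᴴ)) = reTr (S * S * L) := by
    rw [← reTr_conjTranspose, reTr_mul_comm (S * S)]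
    simp [hSH, mul_assoc]
  have a2 : reTr (S * (L * S)) = reTr (S * S * L) := by
    rw [reTr_mul_comm, mul_assoc, reTr_mul_comm]
  have a3 : reTr (S * (Lᴴ * S)) = reTr (S * S * L) := by
    rw [← a1, reTr_mul_comm, mul_assoc, reTr_mul_comm, mul_assoc]
  have n1 := norm_sq_mul_sub_mul_diagMat (U := U) (V := V) hSH s (N / 2)
  have n2 := norm_sq_mul_sub_mul_diagMat (U := U) (V := V) (conjTranspose_sqrt (S := S)) s N
  rw [sqrt_mul_sqrt hS] at n2
  rw [show 2 * (N / 2) = N by omega, ← hL.eq] at n1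
  rw [skewErrorRate, n1, n2, reTr_mul_crossVelocity hL.unitary_left hL.unitary_right s hN,
    ← reTr_apply, ← hLL, ← hLL']
  simp only [Matrix.conjTranspose_sub, hSH, mul_add, mul_sub, sub_mul, map_add, map_sub,
    ← mul_assoc]
  simp only [mul_assoc] at a1 a2 a3 ⊢
  simp only [a1, a2, a3]
  ring

/-- The substitution `j ↦ N/2 - j` exchanges the roles of the two indices. -/
lemma skewWeight_symm {N k : ℕ} (hN : N = 2 * k + 2) (s : Fin d → ℝ) (m n : Fin d) :
    skewWeight N s m n = skewWeight N s n m := by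
  unfold skewWeight
  refine Finset.sum_nbij' (fun j => N / 2 - j) (fun j => N / 2 - j) ?_ ?_ ?_ ?_ fun j hj => ?_
  · intro j hj; simp at hj ⊢; omega
  · intro j hj; simp at hj ⊢; omega
  · intro j hj; simp at hj ⊢; omega
  · intro j hj; simp at hj ⊢; omega
  · have := Finset.mem_Icc.mp hj
    rw [show 2 * (N / 2 - j) = N - 2 * j by omega, show N - (N - 2 * j) = 2 * j by omega, mul_comm]

lemma skewWeight_pos {N : ℕ} (hN : 4 ≤ N) {s : Fin d → ℝ} (hs : ∀ i, 0 < s i) (m n : Fin d) :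
    0 < skewWeight N s m n :=
  Finset.sum_pos (fun _ _ => mul_pos (pow_pos (hs m) _) (pow_pos (hs n) _))
    ⟨1, by simp; omega⟩

lemma skewWeight_nonneg {N : ℕ} {s : Fin d → ℝ} (hs : ∀ i, 0 ≤ s i) (m n : Fin d) :
    0 ≤ skewWeight N s m n :=
  Finset.sum_nonneg fun _ _ => mul_nonneg (pow_nonneg (hs m) _) (pow_nonneg (hs n) _)

/-- Pairing the entries `(m, n)` and `(n, m)` turns the trace into a weighted sum of squares. -/
lemma two_mul_sum_re_eq (Q : Matrix (Fin d) (Fin d) 𝕜) {w : Fin d → Fin d → ℝ}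
    (hw : ∀ m n, w m n = w n m) :
    2 * ∑ m, ∑ n, RCLike.re (star (Q m n) * (Q m n - star (Q n m))) * w m n =
      ∑ m, ∑ n, ‖Q m n - star (Q n m)‖ ^ 2 * w m n := by
  have key : ∀ m n, ‖Q m n - star (Q n m)‖ ^ 2 * w m n =
      RCLike.re (star (Q m n) * (Q m n - star (Q n m))) * w m n
        + RCLike.re (star (Q n m) * (Q n m - star (Q m n))) * w n m := by
    intro m n
    rw [← hw m n, ← add_mul, RCLike.norm_sq_eq_def]
    simp only [RCLike.star_def, map_sub, RCLike.mul_re, RCLike.conj_re, RCLike.conj_im]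
    ring
  simp only [key, Finset.sum_add_distrib]
  rw [Finset.sum_comm (f := fun m n => RCLike.re (star (Q n m) * (Q n m - star (Q m n))) * w n m)]
  ring

lemma reTr_conjTranspose_mul_diagMat (Q Z : Matrix (Fin d) (Fin d) 𝕜) (s : Fin d → ℝ) (p q : ℕ) :
    reTr (Qᴴ * (diagMat 𝕜 s ^ p * Z * diagMat 𝕜 s ^ q)) =
      ∑ m, ∑ n, RCLike.re (star (Q m n) * Z m n) * (s m ^ p * s n ^ q) := by
  rw [reTr_apply, Matrix.trace, map_sum, Finset.sum_comm]
  refine Finset.sum_congr rfl fun n _ => ?_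
  rw [Matrix.diag_apply, Matrix.mul_apply, map_sum]
  refine Finset.sum_congr rfl fun m _ => ?_
  rw [diagMat_pow, diagMat_pow, diagMat, diagMat, Matrix.mul_diagonal, Matrix.diagonal_mul,
    Matrix.conjTranspose_apply, mul_comm (RCLike.re _), ← RCLike.re_ofReal_mul]
  congr 1
  push_cast
  ring

lemma skewErrorRate_eq_sum_sq {S U V : Matrix (Fin d) (Fin d) 𝕜} {s : Fin d → ℝ} {N k : ℕ}
    (hS : S.PosSemidef) (hN : N = 2 * k + 2) :
    skewErrorRate N S U s V =
      -2 * ‖S * (U - V) * diagMat 𝕜 s ^ (N / 2)‖ ^ 2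
        - 2 * ‖CFC.sqrt S * (U - V) * diagMat 𝕜 s ^ N‖ ^ 2
        - ∑ m, ∑ n, ‖(Uᴴ * S * V) m n - star ((Uᴴ * S * V) n m)‖ ^ 2 * skewWeight N s m n := by
  have hSH : Sᴴ = S := hS.isHermitian
  have hQH : Vᴴ * S * U = (Uᴴ * S * V)ᴴ := by simp [hSH, mul_assoc]
  rw [skewErrorRate, ← two_mul_sum_re_eq _ (skewWeight_symm hN s), ← reTr_apply, map_sum]
  congr 2
  have h : ∀ j, reTr (S * U * diagMat 𝕜 s ^ (2 * j) * (Uᴴ * S * V - Vᴴ * S * U)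
      * diagMat 𝕜 s ^ (N - 2 * j) * Vᴴ) =
      ∑ m, ∑ n, RCLike.re (star ((Uᴴ * S * V) m n)
        * ((Uᴴ * S * V) m n - star ((Uᴴ * S * V) n m))) * (s m ^ (2 * j) * s n ^ (N - 2 * j)) := by
    intro j
    rw [reTr_mul_comm]
    have := reTr_conjTranspose_mul_diagMat (Uᴴ * S * V) (Uᴴ * S * V - Vᴴ * S * U) s (2 * j)
      (N - 2 * j)
    rw [← hQH] at this
    simp only [mul_assoc] at this ⊢
    rw [this]
    simp only [← mul_assoc, hQH, Matrix.sub_apply, Matrix.conjTranspose_apply]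
  simp only [h, skewWeight, Finset.mul_sum]
  rw [Finset.sum_comm]
  refine Finset.sum_congr rfl fun m _ => ?_
  rw [Finset.sum_comm]

lemma IsGradientFlow.hasDerivWithinAt_skewError {N k : ℕ} {a : ℝ} {S : Matrix (Fin d) (Fin d) 𝕜}
    {W : ℝ → ℕ → Matrix (Fin d) (Fin d) 𝕜} {U V : ℝ → Matrix (Fin d) (Fin d) 𝕜}
    {s : ℝ → Fin d → ℝ} (hflow : IsGradientFlow N a S W) (hN : N = 2 * k + 2) (hS : S.PosSemidef)
    (hbal : ∀ t, 0 ≤ t → IsBalanced N (W t))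
    (hsvd : ∀ t : ℝ, 0 ≤ t → IsRootSVD N (layerProd (W t) N) (U t) (s t) (V t))
    (hpos : ∀ t, 0 ≤ t → ∀ i, 0 < s t i) {t : ℝ} (ht : 0 ≤ t) :
    HasDerivWithinAt (fun τ => skewError S (U τ) (s τ) (V τ))
      (skewErrorRate N S (U t) (s t) (V t)) (Set.Ici 0) t := by
  have hN0 : 0 < N := by omega
  have hB := hasDerivWithinAt_reTr
    ((hflow.hasDerivWithinAt_last hN0 ht (hbal t ht)).const_mul S)
  have hA := hasDerivWithinAt_reTr
    ((hflow.hasDerivWithinAt_first hN0 ht (hbal t ht)).const_mul S)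
  have hC := hasDerivWithinAt_reTr
    ((hflow.hasDerivWithinAt_cross hN hS.isHermitian hbal hsvd hpos ht).const_mul S)
  have heq : ∀ τ, 0 ≤ τ → skewError S (U τ) (s τ) (V τ) =
      reTr (S * (W τ N * (W τ N)ᴴ)) + reTr (S * ((W τ 1)ᴴ * W τ 1))
        - 2 * reTr (S * (U τ * diagMat 𝕜 (s τ) ^ 2 * (V τ)ᴴ)) := fun τ hτ => by
    rw [skewError_eq hS, (hsvd τ hτ).last_mul_conjTranspose (hbal τ hτ) hN0,
      (hsvd τ hτ).conjTranspose_mul_first (hbal τ hτ) hN0]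
  rw [skewErrorRate_eq hS (hsvd t ht) hN]
  exact ((hB.fun_add hA).fun_sub (hC.const_mul 2)).congr (fun τ hτ => heq τ hτ) (heq t ht)

end DeepMF

theorem mainTheorem8 {𝕜 : Type*} [RCLike 𝕜] {d N : ℕ} (hN : 0 < N) (hN2 : 2 ∣ N)
    (a : ℝ) (ha : 0 ≤ a)
    (S : Matrix (Fin d) (Fin d) 𝕜) (hS : S.PosSemidef)
    (W : ℝ → ℕ → Matrix (Fin d) (Fin d) 𝕜)
    (hflow : DeepMF.IsGradientFlow N a S W)
    (hbal : DeepMF.IsBalanced N (W 0))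
    (U V : ℝ → Matrix (Fin d) (Fin d) 𝕜) (s : ℝ → Fin d → ℝ)
    (hsvd : ∀ t : ℝ, 0 ≤ t → DeepMF.IsRootSVD N (DeepMF.layerProd (W t) N) (U t) (s t) (V t))
    (hs0 : ∀ i, s 0 i ^ N ≠ 0) :
    ∀ t : ℝ, 0 ≤ t →
      HasDerivWithinAt (fun τ => DeepMF.skewError S (U τ) (s τ) (V τ))
        (DeepMF.skewErrorRate N S (U t) (s t) (V t)) (Set.Ici 0) t ∧
      DeepMF.skewErrorRate N S (U t) (s t) (V t) =
        -2 * ‖S * (U t - V t) * DeepMF.diagMat 𝕜 (s t) ^ (N / 2)‖ ^ 2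
          - 2 * ‖CFC.sqrt S * (U t - V t) * DeepMF.diagMat 𝕜 (s t) ^ N‖ ^ 2
          - ∑ m, ∑ n, ‖((U t)ᴴ * S * V t) m n - star (((U t)ᴴ * S * V t) n m)‖ ^ 2
              * DeepMF.skewWeight N (s t) m n ∧
      (4 ≤ N → ∀ m n, 0 < DeepMF.skewWeight N (s t) m n) ∧
      DeepMF.skewErrorRate N S (U t) (s t) (V t) ≤ 0 := by
  intro t ht
  obtain ⟨k, hk⟩ : ∃ k, N = 2 * k + 2 := ⟨N / 2 - 1, by omega⟩
  have hbal' : ∀ τ, 0 ≤ τ → DeepMF.IsBalanced N (W τ) := fun τ hτ => hflow.isBalanced ha hbal hτ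
  have hpos : ∀ τ, 0 ≤ τ → ∀ i, 0 < s τ i := fun τ hτ i =>
    hflow.singularValue_pos (by omega) hbal' hsvd
      (fun i h => hs0 i (by rw [h, zero_pow hN.ne'])) hτ i
  have hrate := DeepMF.skewErrorRate_eq_sum_sq (U := U t) (V := V t) (s := s t) hS hk
  refine ⟨?_, hrate, fun h4 => DeepMF.skewWeight_pos h4 (hpos t ht), ?_⟩
  · exact hflow.hasDerivWithinAt_skewError hk hS hbal' hsvd hpos ht
  · rw [hrate]
    have h3 : 0 ≤ ∑ m, ∑ n, ‖((U t)ᴴ * S * V t) m n - star (((U t)ᴴ * S * V t) n m)‖ ^ 2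
        * DeepMF.skewWeight N (s t) m n :=
      Finset.sum_nonneg fun m _ => Finset.sum_nonneg fun n _ =>
        mul_nonneg (sq_nonneg _) (DeepMF.skewWeight_nonneg (hsvd t ht).nonneg m n)
    linarith [sq_nonneg ‖S * (U t - V t) * DeepMF.diagMat 𝕜 (s t) ^ (N / 2)‖,
      sq_nonneg ‖CFC.sqrt S * (U t - V t) * DeepMF.diagMat 𝕜 (s t) ^ N‖]
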